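/- Setting. Let $\Sigma=(\Sigma_0,\Sigma_1,\Sigma_2)$ be a simply connected quadrilateral cell complex (vertices, edges, quadrilateral faces): any two vertices are joined by an edge path, and every closed edge path can be contracted by means of face flips (replacing $i\to j\to k$ by $i\to l\to k$ for a face $(ijkl)$) and by dropping or inserting single edge return trips. Let $\mathbb R^{3,1}$ be the space of Hermitian $2\times2$ matrices with the quadratic form $(X,X)=-\det X$, let $$H^3=\{X \mid \det X=1,\ \operatorname{tr}X>0\},\qquad S^{2,1}=\{N\mid \det N=-1\},$$ and let $\mathbb R^{4,2}=\mathbb R^{3,1}\oplus_\perp\langle p,q\rangle$ with $-(p,p)=(q,q)=1$, $p\perp q$. A discrete flat front is a map $(X,N):\Sigma_0\to H^3\times S^{2,1}$ with $(X_i,N_i)=0$ for all vertices $i$ such that * (Legendre net) for every edge $(ij)$ the contact elements $\langle X_i-q,\,N_i+p\rangle$ and $\langle X_j-q,\,N_j+p\rangle$ in $\mathbb R^{4,2}$ have a non-zero intersection (a common curvature sphere), and * (linear Weingarten with mixed area Gauss curvature $K\equiv1$) on every face $(ijkl)$ one has $A(X,X)_{ijkl}\neq0$ and $A(N,N)_{ijkl}=K\,A(X,X)_{ijkl}$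 with $K=1$, where $A$ is the $\Lambda^2\mathbb R^{3,1}$-valued mixed area, the symmetric bilinear form with $A(H,H)_{ijkl}=\tfrac12\,(H_k-H_i)\wedge(H_l-H_j)$. Its hyperbolic Gauss maps are the maps $\langle X\pm N\rangle$ into the set of null lines of $\mathbb R^{3,1}$. Assume that they are regular, that is, that for every edge $(ij)$ the four null lines $\langle X_i\pm N_i\rangle$, $\langle X_j\pm N_j\rangle$ are pairwise distinct. Corollary. Every discrete flat front $(X,N):\Sigma_0\to H^3\times S^{2,1}$ with regular hyperbolic Gauss maps admits a Weierstrass-type representation. That is, there are * a discrete holomorphic function $g:\Sigma_0\to\mathbb C$ with a real edge-labelling $a$, i.e. numbers $a_{ij}=a_{ji}\in\mathbb R\setminus\{0\}$ on the edges with $a_{ij}=a_{kl}$ on every face $(ijkl)$, such that $g_i\neq g_j$ on every edge and, on every face $(ijkl)$, $$\frac{g_j-g_i}{g_k-g_j}\cdot\frac{g_l-g_k}{g_i-g_l}=\frac{a_{ij}}{a_{jk}}\neq 0,1,\infty;$$ * a parameter $t\in\mathbb R\setminus\{0\}$ with $1-ta_{ij}>0$ on all edges; * a frame $F:\Sigma_0\to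 \mathrm{SL}(2,\mathbb C)$ with, on every edge $(ij)$, $$F_j=F_i\,W_{ij},\qquad W_{ij}=\frac1{\sqrt{1-ta_{ij}}}\begin{pmatrix}1& g_j-g_i\\[2pt] \dfrac{t a_{ij}}{g_j-g_i}&1\end{pmatrix};$$ * and $s\in\mathbb R$, such that, with $E_0=\begin{pmatrix}1&0\\0&1\end{pmatrix}$ and $E_3=\begin{pmatrix}1&0\\0&-1\end{pmatrix}$, at every vertex $$X=F\,(E_0\cosh s+E_3\sinh s)\,F^*,\qquad N=F\,(E_0\sinh s+E_3\cosh s)\,F^* .$$ -/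

import Mathlib

open scoped Matrix

namespace FlatFront

/-! ### Quadrilateral cell complexes -/

/-- A quadrilateral cell complex on a vertex set `V`. The (oriented) edges `(ij)` are the ordered
pairs of adjacent vertices of `graph`; `IsFace i j k l` says that `(ijkl)` is an oriented
quadrilateral face, with edges `(ij), (jk), (kl), (li)`; a face may be read off starting at any of
its vertices. -/
structure QuadComplex (V : Type*) where
  graph : SimpleGraph V
  IsFace : V → V → V → V → Prop
  adj_of_isFace : ∀ {i j k l : V}, IsFace i j k l → graph.Adj i j
  rotate : ∀ {i j k l : V}, IsFace i j k l → IsFace j k l i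
  diag_ne : ∀ {i j k l : V}, IsFace i j k l → i ≠ k

namespace QuadComplex

variable {V : Type*} (S : QuadComplex V)

theorem adj₁ {i j k l : V} (h : S.IsFace i j k l) : S.graph.Adj i j := S.adj_of_isFace h

theorem adj₂ {i j k l : V} (h : S.IsFace i j k l) : S.graph.Adj j k :=
  S.adj_of_isFace (S.rotate h)

theorem adj₃ {i j k l : V} (h : S.IsFace i j k l) : S.graph.Adj k l :=
  S.adj_of_isFace (S.rotate (S.rotate h))

theorem adj₄ {i j k l : V} (h : S.IsFace i j k l) : S.graph.Adj l i :=
  S.adj_of_isFace (S.rotate (S.rotate (S.rotate h)))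

/-- Combinatorial homotopy (with fixed end points) of edge paths: the equivalence relation, stable
under prolonging paths, generated by dropping single edge return trips `i → j → i` and by face
flips, which replace `i → j → k` by `i → l → k` for a face `(ijkl)`. -/
inductive Homotopic : ∀ {u v : V}, S.graph.Walk u v → S.graph.Walk u v → Prop
  | refl {u v : V} (p : S.graph.Walk u v) : Homotopic p p
  | symm {u v : V} {p q : S.graph.Walk u v} : Homotopic p q → Homotopic q p
  | trans {u v : V} {p q r : S.graph.Walk u v} : Homotopic p q → Homotopic q r → Homotopic p r
  | cons {u v w : V} (h : S.graph.Adj u v) {p q : S.graph.Walk v w} :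
      Homotopic p q → Homotopic (.cons h p) (.cons h q)
  | returnTrip {i j w : V} (h : S.graph.Adj i j) (p : S.graph.Walk i w) :
      Homotopic (.cons h (.cons h.symm p)) p
  | faceFlip {i j k l w : V} (h : S.IsFace i j k l) (p : S.graph.Walk k w) :
      Homotopic (.cons (S.adj₁ h) (.cons (S.adj₂ h) p))
        (.cons (S.adj₄ h).symm (.cons (S.adj₃ h).symm p))

/-- Any two vertices are joined by an edge path, and every closed edge path is null-homotopic. -/
def SimplyConnected : Prop :=
  S.graph.Preconnected ∧ ∀ (u : V) (p : S.graph.Walk u u), S.Homotopic p .nil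

end QuadComplex

/-! ### Hyperbolic geometry in the space of Hermitian matrices -/

/-- The real vector space of Hermitian `2 × 2` matrices. -/
abbrev Herm2 : Type := selfAdjoint (Matrix (Fin 2) (Fin 2) ℂ)

/-- The Minkowski product on `Herm2`: the polarization of the quadratic form `-det`. -/
noncomputable def minkowski (X Y : Herm2) : ℝ :=
  ((X - Y : Matrix (Fin 2) (Fin 2) ℂ).det - (X + Y : Matrix (Fin 2) (Fin 2) ℂ).det).re / 4

/-- Hyperbolic space `H³`: a sheet of the two-sheeted unit hyperboloid. -/
def hyperbolicSpace : Set Herm2 :=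
  {X | minkowski X X = -1 ∧ 0 < (X : Matrix (Fin 2) (Fin 2) ℂ).trace.re}

/-- The de Sitter space `S^{2,1}` of unit spacelike vectors. -/
def deSitterSpace : Set Herm2 := {N | minkowski N N = 1}

/-! ### Discrete Legendre nets, mixed area and flat fronts -/

/-- The contact element `⟨X - q, N + p⟩` of a point `X` of hyperbolic space with unit normal `N`,
as a plane in `ℝ^{4,2} = ℝ^{3,1} ⊕ ⟨p, q⟩`, where `p = (0, 1, 0)` is the (timelike) point sphere
complex and `q = (0, 0, 1)` is the (spacelike) plane complex. -/
noncomputable def contactElement (X N : Herm2) : Submodule ℝ (Herm2 × ℝ × ℝ) :=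
  Submodule.span ℝ {(X, 0, -1), (N, 1, 0)}

/-- `v ∧ w` in the second exterior power of `ℝ^{3,1}`. -/
noncomputable def wedge (v w : Herm2) : ⋀[ℝ]^2 Herm2 := exteriorPower.ιMulti ℝ 2 ![v, w]

/-- The mixed area of two vertex maps on a quadrilateral `(ijkl)`: the symmetric bilinear form with
quadratic form `A(H, H) = ½ (H_k - H_i) ∧ (H_l - H_j)`. -/
noncomputable def mixedArea {V : Type*} (H G : V → Herm2) (i j k l : V) : ⋀[ℝ]^2 Herm2 :=
  (1 / 4 : ℝ) • (wedge (H k - H i) (G l - G j) + wedge (G k - G i) (H l - H j))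

/-- `K` is the mixed area Gauss curvature of `(X, N)` on the quadrilateral `(ijkl)`: it is the
coefficient determined by `A(N, N) = K A(X, X)`, where `A(X, X) ≠ 0`. -/
def IsGaussCurvature {V : Type*} (X N : V → Herm2) (i j k l : V) (K : ℝ) : Prop :=
  mixedArea X X i j k l ≠ 0 ∧ mixedArea N N i j k l = K • mixedArea X X i j k l

variable {V : Type*}

/-- `(X, N)` is a net in `H³` with unit normals `N`, and the contact elements at the two ends of any
edge share a curvature sphere. -/
structure IsLegendreNet (S : QuadComplex V) (X N : V → Herm2) : Prop where
  mem_hyperbolicSpace : ∀ i, X i ∈ hyperbolicSpace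
  mem_deSitterSpace : ∀ i, N i ∈ deSitterSpace
  orthogonal : ∀ i, minkowski (X i) (N i) = 0
  curvatureSphere : ∀ i j, S.graph.Adj i j →
    contactElement (X i) (N i) ⊓ contactElement (X j) (N j) ≠ ⊥

/-- A discrete flat front: a discrete Legendre net in hyperbolic space which is linear Weingarten
with constant mixed area Gauss curvature `1`. -/
structure IsFlatFront (S : QuadComplex V) (X N : V → Herm2) : Prop extends
    IsLegendreNet S X N where
  gaussCurvature : ∀ i j k l, S.IsFace i j k l → IsGaussCurvature X N i j k l 1

/-- The hyperbolic Gauss map `⟨X + N⟩`, with values in the null lines of `ℝ^{3,1}`. -/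
noncomputable def gaussMapPos (X N : V → Herm2) (i : V) : Submodule ℝ Herm2 := Submodule.span ℝ {X i + N i}

/-- The hyperbolic Gauss map `⟨X - N⟩`, with values in the null lines of `ℝ^{3,1}`. -/
noncomputable def gaussMapNeg (X N : V → Herm2) (i : V) : Submodule ℝ Herm2 := Submodule.span ℝ {X i - N i}

/-- On every edge `(ij)` the four values of the hyperbolic Gauss maps are pairwise distinct. (The
two values at the same vertex always are distinct, and the edge `(ji)` gives the sixth pair.) -/
def RegularGaussMaps (S : QuadComplex V) (X N : V → Herm2) : Prop :=
  ∀ i j, S.graph.Adj i j →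
    gaussMapPos X N i ≠ gaussMapPos X N j ∧
    gaussMapNeg X N i ≠ gaussMapNeg X N j ∧
    gaussMapPos X N i ≠ gaussMapNeg X N j

/-! ### Discrete holomorphic functions and the Weierstrass representation -/

/-- The cross ratio of a quadrilateral of complex numbers. -/
noncomputable def crossRatio (z₁ z₂ z₃ z₄ : ℂ) : ℂ :=
  ((z₂ - z₁) / (z₃ - z₂)) * ((z₄ - z₃) / (z₁ - z₄))

/-- A real edge-labelling. -/
structure IsEdgeLabelling (S : QuadComplex V) (a : V → V → ℝ) : Prop where
  symm : ∀ i j, S.graph.Adj i j → a i j = a j i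
  face : ∀ i j k l, S.IsFace i j k l → a i j = a k l

/-- `g` is a discrete holomorphic function with cross ratio factorizing edge-labelling `a`. The
first two regularity conditions are automatic for edges of faces, by the other conditions; the first
one says that no cross ratio is infinite or undefined. -/
structure IsHolomorphic (S : QuadComplex V) (g : V → ℂ) (a : V → V → ℝ) : Prop where
  edgeLabelling : IsEdgeLabelling S a
  ne_of_adj : ∀ i j, S.graph.Adj i j → g i ≠ g j
  label_ne_zero : ∀ i j, S.graph.Adj i j → a i j ≠ 0
  crossRatio_eq : ∀ i j k l, S.IsFace i j k l →
    crossRatio (g i) (g j) (g k) (g l) = (a i j / a j k : ℝ)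
  crossRatio_ne_zero : ∀ i j k l, S.IsFace i j k l → crossRatio (g i) (g j) (g k) (g l) ≠ 0
  crossRatio_ne_one : ∀ i j k l, S.IsFace i j k l → crossRatio (g i) (g j) (g k) (g l) ≠ 1

/-- The transition matrix on an edge, where `dg` is the difference of the values of the holomorphic
function and `a` is the label. -/
noncomputable def transition (t a : ℝ) (dg : ℂ) : Matrix (Fin 2) (Fin 2) ℂ :=
  (1 / (Real.sqrt (1 - t * a) : ℂ)) • !![1, dg; ((t * a : ℝ) : ℂ) / dg, 1]

/-- `E₀`, the identity matrix. -/
def E₀ : Matrix (Fin 2) (Fin 2) ℂ := !![1, 0; 0, 1]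

/-- The Pauli matrix `E₃`. -/
def E₃ : Matrix (Fin 2) (Fin 2) ℂ := !![1, 0; 0, -1]

/-- `(X, N)` is obtained by the Weierstrass representation from the discrete holomorphic function
`g` with edge-labelling `a`, the spectral parameter `t` and a frame `F`, as the member with
parameter `s` of the resulting parallel family. -/
structure IsWeierstrassRepresentation (S : QuadComplex V) (X N : V → Herm2) (g : V → ℂ)
    (a : V → V → ℝ) (t : ℝ) (F : V → Matrix.SpecialLinearGroup (Fin 2) ℂ) (s : ℝ) : Prop where
  holomorphic : IsHolomorphic S g a
  t_ne_zero : t ≠ 0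
  radicand_pos : ∀ i j, S.graph.Adj i j → 0 < 1 - t * a i j
  frame : ∀ i j, S.graph.Adj i j →
    (F j : Matrix (Fin 2) (Fin 2) ℂ) = F i * transition t (a i j) (g j - g i)
  point : ∀ i, (X i : Matrix (Fin 2) (Fin 2) ℂ) =
    F i * ((Real.cosh s : ℂ) • E₀ + (Real.sinh s : ℂ) • E₃) * (F i : Matrix (Fin 2) (Fin 2) ℂ)ᴴ
  normal : ∀ i, (N i : Matrix (Fin 2) (Fin 2) ℂ) =
    F i * ((Real.sinh s : ℂ) • E₀ + (Real.cosh s : ℂ) • E₃) * (F i : Matrix (Fin 2) (Fin 2) ℂ)ᴴ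

end FlatFront

open scoped ComplexConjugate

/-! At each vertex there is `F` in SL(2,ℂ) with `X = F F*` and `N = F E₃ F*`, and `F` may be rotated
about the normal by a unit complex number. This already is the representation with `s = 0`, so the
whole content lies in the transitions `M = F_i⁻¹ F_j`. A common curvature sphere says that `M`
preserves a Hermitian form `diag(d₁, d₂)`. Regularity of the Gauss maps makes `d₁`, `d₂` and the
entries of `M` nonzero, so `M` has rows `(α, β)` and `(ρ β̄, ᾱ)` with `ρ` real, and `d(X + N) = ρ
d(X - N)` on the edge. On a face, `K = 1` says that the mixed area of `X + N` and `X - N` vanishes.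
This yields a relation between the four `ρ` which, put into the closing condition `M₁ M₂ = M₄ M₃`,
makes `α` multiplicative: `α₁ α₂ = α₄ α₃` (`IsGaussCurvature.isClosedFace`). Its phase is therefore
exact and can be rotated away (`exists_adapted_frame`), leaving `α = r > 0`. Now `β / r` is additive
around faces and integrates to `g`, while `a = 1 - r⁻²` with `t = 1` makes `M` the required
transition matrix. The labelling and cross ratio conditions follow face by face
(`labels_of_closed`). -/

namespace FlatFront

/-! ### Integration of closed group-valued functions of the edges -/

namespace QuadComplex

variable {V : Type*} (S : QuadComplex V)

/-- The product of the values of a group-valued function of the edges along an edge path. -/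
def holonomy {H : Type*} [Group H] (f : V → V → H) : ∀ {u v : V}, S.graph.Walk u v → H
  | _, _, .nil => 1
  | u, _, .cons (v := v) _ p => f u v * holonomy f p

variable {S} {H : Type*} [Group H] {f : V → V → H}

theorem holonomy_append {u v w : V} (p : S.graph.Walk u v) (q : S.graph.Walk v w) :
    S.holonomy f (p.append q) = S.holonomy f p * S.holonomy f q := by
  induction p with
  | nil => simp [holonomy]
  | cons h p ih => simp [holonomy, ih, mul_assoc]

theorem holonomy_reverse (hinv : ∀ i j, S.graph.Adj i j → f j i = (f i j)⁻¹) {u v : V}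
    (p : S.graph.Walk u v) : S.holonomy f p.reverse = (S.holonomy f p)⁻¹ := by
  induction p with
  | nil => simp [holonomy]
  | cons h p ih => simp [holonomy, holonomy_append, ih, hinv _ _ h]

theorem Homotopic.holonomy_eq (hinv : ∀ i j, S.graph.Adj i j → f j i = (f i j)⁻¹)
    (hface : ∀ i j k l, S.IsFace i j k l → f i j * f j k = f i l * f l k) {u v : V}
    {p q : S.graph.Walk u v} (h : S.Homotopic p q) : S.holonomy f p = S.holonomy f q := by
  induction h with
  | refl p => rfl
  | symm _ ih => exact ih.symm
  | trans _ _ ih₁ ih₂ => exact ih₁.trans ih₂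
  | cons h _ ih => simp [holonomy, ih]
  | returnTrip h p => simp [holonomy, hinv _ _ h]
  | faceFlip h p => simp only [holonomy, ← mul_assoc, hface _ _ _ _ h]

/-- On a simply connected complex, a closed group-valued function of the edges is exact. -/
theorem SimplyConnected.exists_potential (hS : S.SimplyConnected)
    (hinv : ∀ i j, S.graph.Adj i j → f j i = (f i j)⁻¹)
    (hface : ∀ i j k l, S.IsFace i j k l → f i j * f j k = f i l * f l k) :
    ∃ φ : V → H, ∀ i j, S.graph.Adj i j → φ j = φ i * f i j := by
  rcases isEmpty_or_nonempty V with hV | ⟨⟨u⟩⟩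
  · exact ⟨fun _ ↦ 1, fun i ↦ hV.elim i⟩
  let p (v : V) : S.graph.Walk u v := (hS.1 u v).some
  refine ⟨fun v ↦ S.holonomy f (p v), fun i j h ↦ ?_⟩
  -- The loop from the base point to `i`, across the edge to `j` and back has trivial holonomy.
  have := (hS.2 u ((p i).append (.cons h (p j).reverse))).holonomy_eq hinv hface
  simp only [holonomy_append, holonomy, holonomy_reverse hinv, ← mul_assoc, mul_inv_eq_one]
    at this
  exact this.symm

end QuadComplex

/-! ### Wedge products and mixed area on a face -/

theorem wedge_add_left (u v w : Herm2) : wedge (u + v) w = wedge u w + wedge v w :=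
  (exteriorPower.ιMulti ℝ 2 (M := Herm2)).toMultilinearMap.cons_add ![w] u v

theorem wedge_smul_left (c : ℝ) (u w : Herm2) : wedge (c • u) w = c • wedge u w :=
  (exteriorPower.ιMulti ℝ 2 (M := Herm2)).toMultilinearMap.cons_smul ![w] c u

theorem wedge_self (u : Herm2) : wedge u u = 0 :=
  (exteriorPower.ιMulti ℝ 2).map_eq_zero_of_eq _ (i := 0) (j := 1) (by simp) (by simp)

theorem wedge_swap (u v : Herm2) : wedge v u = -wedge u v := by
  rw [wedge, wedge,
    ← (exteriorPower.ιMulti ℝ 2).map_swap ![u, v] (by simp : (0 : Fin 2) ≠ 1)]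
  congr 1
  ext i : 1
  fin_cases i <;> simp

theorem wedge_add_right (u v w : Herm2) : wedge u (v + w) = wedge u v + wedge u w := by
  rw [wedge_swap, wedge_add_left, neg_add, ← wedge_swap, ← wedge_swap]

theorem wedge_smul_right (c : ℝ) (u v : Herm2) : wedge u (c • v) = c • wedge u v := by
  rw [wedge_swap, wedge_smul_left, wedge_swap v u, smul_neg]

/-- The wedge product as a bilinear map. -/
noncomputable def wedgeBilin : Herm2 →ₗ[ℝ] Herm2 →ₗ[ℝ] ⋀[ℝ]^2 Herm2 :=
  LinearMap.mk₂ ℝ wedge wedge_add_left wedge_smul_left wedge_add_right wedge_smul_right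

/-- The edge coefficients `ρ`, with `dP = ρ dQ`, of an edge-parallel pair of quadrilaterals `P`, `Q`
with mutual mixed area zero. -/
theorem edge_coefficients_of_mixedArea {E W : Type*} [AddCommGroup E] [Module ℝ E]
    [AddCommGroup W] [Module ℝ W] (B : E →ₗ[ℝ] E →ₗ[ℝ] W) (hB : B.IsAlt)
    {P₁ P₂ P₃ P₄ Q₁ Q₂ Q₃ Q₄ : E} {ρ₁ ρ₂ ρ₃ ρ₄ : ℝ} (hρ₁ : ρ₁ ≠ 0)
    (h₁ : P₂ - P₁ = ρ₁ • (Q₂ - Q₁)) (h₂ : P₃ - P₂ = ρ₂ • (Q₃ - Q₂))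
    (h₃ : P₃ - P₄ = ρ₃ • (Q₃ - Q₄)) (h₄ : P₄ - P₁ = ρ₄ • (Q₄ - Q₁))
    (hPQ : B (P₃ - P₁) (Q₄ - Q₂) + B (Q₃ - Q₁) (P₄ - P₂) = 0)
    (hA : B (P₃ - P₁) (P₄ - P₂) + B (Q₃ - Q₁) (Q₄ - Q₂) ≠ 0) :
    ρ₁ * ρ₃ = ρ₂ * ρ₄ ∧ ρ₁ ≠ ρ₂ ∧ ρ₁ ≠ ρ₄ := by
  obtain ⟨a, ha⟩ : ∃ a, a = Q₂ - Q₁ := ⟨_, rfl⟩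
  obtain ⟨b, hb⟩ : ∃ b, b = Q₃ - Q₂ := ⟨_, rfl⟩
  obtain ⟨c, hc⟩ : ∃ c, c = Q₄ - Q₃ := ⟨_, rfl⟩
  have e₁ : P₃ - P₁ = ρ₁ • a + ρ₂ • b := by
    subst ha hb; linear_combination (norm := module) h₁ + h₂
  have e₂ : P₄ - P₂ = ρ₂ • b + ρ₃ • c := by
    subst hb hc; linear_combination (norm := module) h₂ - h₃
  have e₃ : Q₃ - Q₁ = a + b := by subst ha hb; module
  have e₄ : Q₄ - Q₂ = b + c := by subst hb hc; module
  -- The closing condition of `P`, written in the edges of `Q`. Pairing it with `a`, `b`, `c` gives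
  -- three linear relations between the products `x`, `y`, `z`; zero mixed area gives a fourth, `g`.
  have e₅ : (ρ₁ - ρ₄) • a + (ρ₂ - ρ₄) • b + (ρ₃ - ρ₄) • c = 0 := by
    subst ha hb hc
    linear_combination (norm := module) h₄ + h₃ - h₁ - h₂
  have f₁ := congrArg (B a) e₅
  have f₂ := congrArg (B b) e₅
  have f₃ := congrArg (B c) e₅
  rw [e₁, e₂, e₃, e₄] at hPQ hA
  simp only [map_add, map_smul, LinearMap.add_apply, LinearMap.smul_apply, hB.self_eq_zero,
    map_zero, ← hB.neg a b, ← hB.neg a c, ← hB.neg b c] at hPQ hA f₁ f₂ f₃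
  generalize B a b = x at *
  generalize B a c = y at *
  generalize B b c = z at *
  have g : (ρ₁ + ρ₂) • x + (ρ₁ + ρ₃) • y + (ρ₂ + ρ₃) • z = 0 := by
    linear_combination (norm := module) hPQ
  have hA : ¬ ((1 + ρ₁ * ρ₂) • x + (1 + ρ₁ * ρ₃) • y + (1 + ρ₂ * ρ₃) • z = 0) := by
    intro h
    refine hA ?_
    linear_combination (norm := module) h
  -- By elimination, `ρ₁ ρ₃ - ρ₂ ρ₄` annihilates `x`, `y` and `z`; if it were nonzero, the area in
  -- `hA` would vanish.
  have hπ : ρ₁ * ρ₃ = ρ₂ * ρ₄ := by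
    by_contra hne
    have hne : ρ₁ * ρ₃ - ρ₂ * ρ₄ ≠ 0 := sub_ne_zero.mpr hne
    refine hA ((smul_eq_zero_iff_right hne).mp ?_)
    have hx : (ρ₁ * ρ₃ - ρ₂ * ρ₄) • x = 0 := by
      linear_combination (norm := module)
        ((ρ₃ - ρ₄) / 2) • g - ((ρ₁ + ρ₃) / 2) • f₁ - ((ρ₂ + ρ₃) / 2) • f₂
    have hy : (ρ₁ * ρ₃ - ρ₂ * ρ₄) • y = 0 := by
      linear_combination (norm := module)
        (-(ρ₂ - ρ₄) / 2) • g + ((ρ₁ + ρ₂) / 2) • f₁ - ((ρ₂ + ρ₃) / 2) • f₃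
    have hz : (ρ₁ * ρ₃ - ρ₂ * ρ₄) • z = 0 := by
      linear_combination (norm := module)
        ((ρ₁ - ρ₄) / 2) • g + ((ρ₁ + ρ₂) / 2) • f₂ + ((ρ₁ + ρ₃) / 2) • f₃
    linear_combination (norm := module)
      (1 + ρ₁ * ρ₂) • hx + (1 + ρ₁ * ρ₃) • hy + (1 + ρ₂ * ρ₃) • hz
  -- An equality of adjacent coefficients forces the equality of the other two. Then either all four
  -- agree and zero mixed area kills the area, or `e₅` makes a diagonal of both quadrilaterals
  -- vanish.
  refine ⟨hπ, ?_, ?_⟩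
  · rintro rfl
    obtain rfl : ρ₃ = ρ₄ := mul_left_cancel₀ hρ₁ hπ
    by_cases h : ρ₁ = ρ₃
    · subst h
      refine hA ((smul_eq_zero_iff_right hρ₁).mp ?_)
      linear_combination (norm := module) ((1 + ρ₁ * ρ₁) / 2) • g
    · refine hA ((smul_eq_zero_iff_right (sub_ne_zero.mpr h)).mp ?_)
      linear_combination (norm := module) (1 + ρ₁ * ρ₁) • f₁ + (1 + ρ₁ * ρ₃) • (-f₃)
  · rintro rfl
    obtain rfl : ρ₃ = ρ₂ := mul_left_cancel₀ hρ₁ (by linarith)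
    by_cases h : ρ₁ = ρ₃
    · subst h
      refine hA ((smul_eq_zero_iff_right hρ₁).mp ?_)
      linear_combination (norm := module) ((1 + ρ₁ * ρ₁) / 2) • g
    · refine hA ((smul_eq_zero_iff_right (sub_ne_zero.mpr h)).mp ?_)
      linear_combination (norm := module) (-(1 + ρ₁ * ρ₃)) • f₁ + (-(1 + ρ₃ * ρ₃)) • f₂

/-- By polarization `A(X + N, X - N) = A(X, X) - A(N, N)`, so `K = 1` is the vanishing of this mixed
area, and `A(X, X) ≠ 0` is the nondegeneracy condition. -/
theorem IsGaussCurvature.edge_coefficients {V : Type*} {X N : V → Herm2} {i j k l : V}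
    (h : IsGaussCurvature X N i j k l 1) {ρ₁ ρ₂ ρ₃ ρ₄ : ℝ} (hρ₁ : ρ₁ ≠ 0)
    (h₁ : X j + N j - (X i + N i) = ρ₁ • (X j - N j - (X i - N i)))
    (h₂ : X k + N k - (X j + N j) = ρ₂ • (X k - N k - (X j - N j)))
    (h₃ : X k + N k - (X l + N l) = ρ₃ • (X k - N k - (X l - N l)))
    (h₄ : X l + N l - (X i + N i) = ρ₄ • (X l - N l - (X i - N i))) :
    ρ₁ * ρ₃ = ρ₂ * ρ₄ ∧ ρ₁ ≠ ρ₂ ∧ ρ₁ ≠ ρ₄ := by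
  obtain ⟨hX, hN⟩ := h
  have e (H : V → Herm2) :
      mixedArea H H i j k l = (1 / 2 : ℝ) • wedgeBilin (H k - H i) (H l - H j) := by
    change (1 / 4 : ℝ) • (wedge _ _ + wedge _ _) = (1 / 2 : ℝ) • wedge _ _
    module
  rw [e] at hX
  rw [e, e, one_smul] at hN
  have hN := smul_right_injective _ (by norm_num : (1 / 2 : ℝ) ≠ 0) hN
  have e₁ : X k + N k - (X i + N i) = (X k - X i) + (N k - N i) := by abel
  have e₂ : X k - N k - (X i - N i) = (X k - X i) - (N k - N i) := by abel
  have e₃ : X l + N l - (X j + N j) = (X l - X j) + (N l - N j) := by abel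
  have e₄ : X l - N l - (X j - N j) = (X l - X j) - (N l - N j) := by abel
  refine edge_coefficients_of_mixedArea wedgeBilin wedge_self hρ₁ h₁ h₂ h₃ h₄ ?_ fun h0 ↦ hX ?_
  · rw [e₁, e₂, e₃, e₄]
    simp only [map_add, map_sub, LinearMap.add_apply, LinearMap.sub_apply] at hN ⊢
    linear_combination (norm := module) (-2 : ℝ) • hN
  · rw [e₁, e₂, e₃, e₄] at h0
    simp only [map_add, map_sub, LinearMap.add_apply, LinearMap.sub_apply] at hN h0 ⊢
    linear_combination (norm := module) (1 / 8 : ℝ) • h0 - (1 / 4 : ℝ) • hN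

/-! ### Labels and cross ratio on a face -/

/-- The labels of a face which closes up. -/
theorem labels_of_closed {b₁ b₂ b₃ b₄ : ℂ} {ρ₁ ρ₂ ρ₃ ρ₄ A₁ A₂ A₃ A₄ : ℝ} (hb₁ : b₁ ≠ 0)
    (hb₂ : b₂ ≠ 0) (hb₃ : b₃ ≠ 0) (hb₄ : b₄ ≠ 0) (hρ₁₂ : ρ₁ ≠ ρ₂) (hρ₁₄ : ρ₁ ≠ ρ₄) (hρ₁ : ρ₁ ≠ 0)
    (hA₁ : ρ₁ * (b₁ * conj b₁) = A₁) (hA₂ : ρ₂ * (b₂ * conj b₂) = A₂)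
    (hA₃ : ρ₃ * (b₃ * conj b₃) = A₃) (hA₄ : ρ₄ * (b₄ * conj b₄) = A₄)
    (h₁ : ρ₁ * (b₁ * conj b₂) = ρ₄ * (b₄ * conj b₃))
    (h₂ : ρ₂ * (b₁ * conj b₂) = ρ₃ * (b₄ * conj b₃))
    (hs : b₁ + b₂ = b₄ + b₃) (hs' : ρ₁ * b₁ + ρ₂ * b₂ = ρ₄ * b₄ + ρ₃ * b₃)
    (hp : (1 - A₁) * (1 - A₂) = (1 - A₄) * (1 - A₃)) :
    A₁ ≠ A₄ ∧ A₁ = A₃ ∧ A₂ = A₄ ∧ (b₁ / b₂) * (b₃ / b₄) = (A₁ / A₂ : ℝ) := by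
  have hc₁ : conj b₁ ≠ 0 := by simpa
  have hr₁₂ : (ρ₁ - ρ₂ : ℂ) ≠ 0 := by exact_mod_cast sub_ne_zero.mpr hρ₁₂
  have hr₁₄ : (ρ₁ - ρ₄ : ℂ) ≠ 0 := by exact_mod_cast sub_ne_zero.mpr hρ₁₄
  have hr₁ : (ρ₁ : ℂ) ≠ 0 := by exact_mod_cast hρ₁
  have hA₁0 : (A₁ : ℂ) ≠ 0 := by rw [← hA₁]; positivity
  have h₁' := congrArg conj h₁
  have h₂' := congrArg conj h₂
  simp only [map_mul, Complex.conj_conj, Complex.conj_ofReal] at h₁' h₂'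
  have hcr : (A₁ : ℂ) * (b₂ * b₄) = A₄ * (b₁ * b₃) := by
    rw [← hA₁, ← hA₄]; linear_combination b₁ * b₄ * h₁'
  -- Equality would mean cross ratio one. Then `b₁ = b₄`: from the sum relation if the diagonal `b₁
  -- + b₂` is nonzero, and otherwise from the weighted relations. This gives `ρ₁ = ρ₄`, which is
  -- excluded.
  have hne : A₁ ≠ A₄ := by
    intro hA
    have hA' : (A₁ : ℂ) = A₄ := by exact_mod_cast hA
    have h₅ : b₂ * b₄ = b₁ * b₃ := mul_left_cancel₀ hA₁0 (by rw [hcr, hA'])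
    have hb : b₁ = b₄ := by
      by_cases h0 : b₁ + b₂ = 0
      · have e₂ : b₂ = -b₁ := by linear_combination h0
        have e₃ : b₃ = -b₄ := by linear_combination h0 - hs
        subst e₂ e₃
        simp only [map_neg] at *
        have : conj b₁ = conj b₄ := by
          refine mul_left_cancel₀ (mul_ne_zero hr₁₂ hb₁) ?_
          linear_combination h₂ - h₁ - conj b₄ * hs'
        exact star_injective this
      · refine mul_right_cancel₀ h0 ?_
        linear_combination b₁ * hs - h₅
    subst hb
    refine mul_ne_zero hr₁₄ (mul_ne_zero hb₁ hc₁) ?_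
    linear_combination hA₁ - hA₄ + hA'
  have hprod : A₁ * A₂ = A₃ * A₄ := by
    have : (A₁ * A₂ : ℂ) = A₃ * A₄ := by
      rw [← hA₁, ← hA₂, ← hA₃, ← hA₄]
      linear_combination ρ₂ * conj b₁ * b₂ * h₁ + ρ₄ * (b₄ * conj b₃) * h₂'
    exact_mod_cast this
  -- By `hprod` and `hp`, the pairs `A₁, A₂` and `A₃, A₄` have equal products and sums, so they
  -- agree up to order; `hne` decides the order.
  have h₁₃ : A₁ = A₃ := by
    refine sub_eq_zero.mp ((mul_eq_zero.mp ?_).resolve_right (sub_ne_zero.mpr hne))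
    linear_combination (A₁ - 1) * hprod - A₁ * hp
  have h₂₄ : A₂ = A₄ := by
    subst h₁₃
    exact mul_left_cancel₀ (by exact_mod_cast hA₁0) hprod
  refine ⟨hne, h₁₃, h₂₄, ?_⟩
  have hA₄0 : (A₄ : ℂ) ≠ 0 := by
    intro h0
    rw [h0, zero_mul] at hcr
    exact mul_ne_zero hA₁0 (mul_ne_zero hb₂ hb₄) hcr
  rw [h₂₄, Complex.ofReal_div, div_mul_div_comm, div_eq_div_iff (mul_ne_zero hb₂ hb₄) hA₄0]
  linear_combination -hcr

/-! ### Frames at a vertex -/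

open Matrix

/-- A singular Hermitian matrix with nonnegative diagonal is of the form `u uᴴ`. -/
theorem exists_eq_mul_conj {P : Matrix (Fin 2) (Fin 2) ℂ} (hP : Pᴴ = P) (hdet : P.det = 0)
    (h₀ : 0 ≤ (P 0 0).re) (h₁ : 0 ≤ (P 1 1).re) :
    ∃ a b : ℂ, P = !![a * conj a, a * conj b; b * conj a, b * conj b] := by
  have e₀ : conj (P 0 0) = P 0 0 := congrFun₂ hP 0 0
  have e₁ : conj (P 1 1) = P 1 1 := congrFun₂ hP 1 1
  have e₂ : conj (P 1 0) = P 0 1 := congrFun₂ hP 0 1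
  have r₀ : ((P 0 0).re : ℂ) = P 0 0 := Complex.conj_eq_iff_re.mp e₀
  have r₁ : ((P 1 1).re : ℂ) = P 1 1 := Complex.conj_eq_iff_re.mp e₁
  rw [det_fin_two] at hdet
  rcases h₀.eq_or_lt with h | h
  · have z₀ : P 0 0 = 0 := by rw [← r₀, ← h]; rfl
    have z₁ : P 1 0 = 0 := by
      rw [z₀, ← e₂, zero_mul, zero_sub, neg_eq_zero, mul_eq_zero] at hdet
      simpa using hdet
    have z₂ : P 0 1 = 0 := by rw [← e₂, z₁, map_zero]
    refine ⟨0, (√(P 1 1).re : ℝ), ?_⟩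
    ext i j
    fin_cases i <;> fin_cases j <;>
      simp [z₀, z₁, z₂, Complex.conj_ofReal, ← Complex.ofReal_mul, Real.mul_self_sqrt h₁, r₁]
  · have hs : (√(P 0 0).re : ℂ) * √(P 0 0).re = P 0 0 := by
      rw [← Complex.ofReal_mul, Real.mul_self_sqrt h₀, r₀]
    have hne : (√(P 0 0).re : ℂ) ≠ 0 := by
      exact_mod_cast (Real.sqrt_pos.mpr h).ne'
    have e₂' : conj (P 0 1) = P 1 0 := by rw [← e₂, Complex.conj_conj]
    refine ⟨(√(P 0 0).re : ℝ), P 1 0 / √(P 0 0).re, ?_⟩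
    ext i j
    fin_cases i <;> fin_cases j <;> simp [Complex.conj_ofReal]
    · exact hs.symm
    · rw [e₂]; field_simp
    · field_simp
    · rw [e₂, div_mul_div_comm, hs, eq_div_iff (by rw [← hs]; exact mul_ne_zero hne hne)]
      linear_combination hdet

/-- If `X` is a positive definite, `P` a singular Hermitian matrix, with positive mixed
determinant, then the diagonal of `P` is nonnegative. -/
theorem diag_nonneg_of_mixed_det {a d x y e f z w : ℝ} (ha : 0 < a)
    (hX : a * d - (x * x + y * y) = 1) (hP : e * f - (z * z + w * w) = 0)
    (hm : 0 < a * f + d * e - 2 * (x * z + y * w)) : 0 ≤ e := by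
  by_contra! he
  -- A negative `e` would make the left side negative, while the right side is a sum of squares.
  have : a * e * (a * f + d * e - 2 * (x * z + y * w)) =
      (a * z - e * x) ^ 2 + (a * w - e * y) ^ 2 + e ^ 2 := by
    linear_combination a ^ 2 * hP + e ^ 2 * hX
  have h2 : a * e * (a * f + d * e - 2 * (x * z + y * w)) < 0 :=
    mul_neg_of_neg_of_pos (mul_neg_of_pos_of_neg ha he) hm
  nlinarith [sq_nonneg (a * z - e * x), sq_nonneg (a * w - e * y), sq_nonneg e]

/-- `F` is a frame of the point `X` with normal `N`. -/
structure IsFrame (X N : Herm2) (F : SpecialLinearGroup (Fin 2) ℂ) : Prop where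
  point : (X : Matrix (Fin 2) (Fin 2) ℂ) = F * (F : Matrix (Fin 2) (Fin 2) ℂ)ᴴ
  normal : (N : Matrix (Fin 2) (Fin 2) ℂ) = F * E₃ * (F : Matrix (Fin 2) (Fin 2) ℂ)ᴴ

/-- The vectors `(X ± N) / 2` are null and future-pointing, hence of the form `u u*` and `v v*`. The
matrix with columns `u`, `v` is a frame up to its determinant, which has modulus one because `det X
= 1`. -/
theorem exists_isFrame {X N : Herm2} (hX : X ∈ hyperbolicSpace) (hN : N ∈ deSitterSpace)
    (hXN : minkowski X N = 0) : ∃ F, IsFrame X N F := by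
  obtain ⟨hX, htr⟩ := hX
  obtain ⟨X, hXs⟩ := X
  obtain ⟨N, hNs⟩ := N
  have hXs : Xᴴ = X := hXs
  have hNs : Nᴴ = N := hNs
  have hN : minkowski ⟨N, _⟩ ⟨N, _⟩ = 1 := hN
  simp only [minkowski, det_fin_two, trace_fin_two] at hX hN hXN htr
  have x₀ : conj (X 0 0) = X 0 0 := congrFun₂ hXs 0 0
  have x₁ : conj (X 1 1) = X 1 1 := congrFun₂ hXs 1 1
  have x₂ : conj (X 1 0) = X 0 1 := congrFun₂ hXs 0 1
  have n₀ : conj (N 0 0) = N 0 0 := congrFun₂ hNs 0 0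
  have n₁ : conj (N 1 1) = N 1 1 := congrFun₂ hNs 1 1
  have n₂ : conj (N 1 0) = N 0 1 := congrFun₂ hNs 0 1
  have x₀' := Complex.conj_eq_iff_im.mp x₀
  have x₁' := Complex.conj_eq_iff_im.mp x₁
  have n₀' := Complex.conj_eq_iff_im.mp n₀
  have n₁' := Complex.conj_eq_iff_im.mp n₁
  simp [← x₂, ← n₂, x₀', x₁', n₀', n₁'] at hX hN hXN htr
  have hX' : (X 0 0).re * (X 1 1).re - ((X 1 0).re * (X 1 0).re + (X 1 0).im * (X 1 0).im) = 1 := by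
    linarith
  have hN' : (N 0 0).re * (N 1 1).re - ((N 1 0).re * (N 1 0).re + (N 1 0).im * (N 1 0).im) = -1 := by
    linarith
  have hXN' : (X 0 0).re * (N 1 1).re + (X 1 1).re * (N 0 0).re
      - 2 * ((X 1 0).re * (N 1 0).re + (X 1 0).im * (N 1 0).im) = 0 := by
    linarith
  have hpos : 0 < (X 0 0).re ∧ 0 < (X 1 1).re := by
    constructor <;> by_contra! <;> nlinarith [sq_nonneg (X 1 0).re, sq_nonneg (X 1 0).im]
  have hnull (c : ℝ) (hc : c * c = 1) : ∃ a b : ℂ,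
      (2 : ℝ)⁻¹ • (X + c • N) = !![a * conj a, a * conj b; b * conj a, b * conj b] := by
    have h (i j : Fin 2) : ((2 : ℝ)⁻¹ • (X + c • N)) i j = (2 : ℂ)⁻¹ * (X i j + c * N i j) := by
      simp [mul_add]
    have hre (i j : Fin 2) :
        (((2 : ℝ)⁻¹ • (X + c • N)) i j).re = ((X i j).re + c * (N i j).re) / 2 := by
      simp; ring
    have hd : ((X 0 0).re + c * (N 0 0).re) / 2 * (((X 1 1).re + c * (N 1 1).re) / 2)
        - (((X 1 0).re + c * (N 1 0).re) / 2 * (((X 1 0).re + c * (N 1 0).re) / 2)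
          + ((X 1 0).im + c * (N 1 0).im) / 2 * (((X 1 0).im + c * (N 1 0).im) / 2)) = 0 := by
      linear_combination (1 / 4) * hX' + c ^ 2 / 4 * hN' + c / 4 * hXN' - (1 / 4) * hc
    refine exists_eq_mul_conj ?_ ?_ ?_ ?_
    · simp [hXs, hNs]
    · rw [det_fin_two, h, h, h, h, ← x₂, ← n₂]
      apply Complex.ext
      · simp [x₀', x₁', n₀', n₁']
        linear_combination hd
      · simp [x₀', x₁', n₀', n₁']
        ring
    · rw [hre]
      refine diag_nonneg_of_mixed_det hpos.1 hX' hd ?_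
      linear_combination (-1) * hX' - c / 2 * hXN'
    · rw [hre]
      refine diag_nonneg_of_mixed_det (d := (X 0 0).re) (x := (X 1 0).re) (y := (X 1 0).im)
        (f := ((X 0 0).re + c * (N 0 0).re) / 2) (z := ((X 1 0).re + c * (N 1 0).re) / 2)
        (w := ((X 1 0).im + c * (N 1 0).im) / 2) hpos.2 (by linear_combination hX')
        (by linear_combination hd) ?_
      linear_combination (-1) * hX' - c / 2 * hXN'
  obtain ⟨a, b, hP⟩ := hnull 1 (by norm_num)
  obtain ⟨c, d, hQ⟩ := hnull (-1) (by norm_num)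
  have hXe : X = !![a, c; b, d] * !![a, c; b, d]ᴴ := by
    have : X = (2 : ℝ)⁻¹ • (X + (1 : ℝ) • N) + (2 : ℝ)⁻¹ • (X + (-1 : ℝ) • N) := by module
    rw [this, hP, hQ]
    ext i j
    fin_cases i <;> fin_cases j <;> simp [mul_apply]
  have hNe : N = !![a, c; b, d] * E₃ * !![a, c; b, d]ᴴ := by
    have : N = (2 : ℝ)⁻¹ • (X + (1 : ℝ) • N) - (2 : ℝ)⁻¹ • (X + (-1 : ℝ) • N) := by module
    rw [this, hP, hQ]
    ext i j
    fin_cases i <;> fin_cases j <;> simp [mul_apply, E₃, sub_eq_add_neg]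
  obtain ⟨D, hD⟩ : ∃ D, D = a * d - c * b := ⟨_, rfl⟩
  have hDD : D * conj D = 1 := by
    have hdet : X.det = 1 := by
      rw [det_fin_two, ← x₂]
      apply Complex.ext
      · simp [x₀', x₁']; linarith
      · simp [x₀', x₁']; ring
    have := congrArg det hXe
    rw [det_mul, det_conjTranspose, hdet, det_fin_two_of, ← hD] at this
    exact this.symm
  have hD0 : D ≠ 0 := left_ne_zero_of_mul_eq_one hDD
  -- Dividing the second column by the unimodular `D` normalizes the determinant without changing
  -- `X` or `N`.
  have hfac : !![a, c / D; b, d / D] = !![a, c; b, d] * !![1, 0; 0, conj D] := by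
    rw [← inv_eq_of_mul_eq_one_right hDD]
    ext i j
    fin_cases i <;> fin_cases j <;> simp [mul_apply, div_eq_mul_inv]
  have hU : !![1, 0; 0, conj D] * !![1, 0; 0, conj D]ᴴ = 1 := by
    ext i j
    fin_cases i <;> fin_cases j <;> simp [mul_apply, mul_comm (conj D), hDD]
  have hU' : !![1, 0; 0, conj D] * E₃ * !![1, 0; 0, conj D]ᴴ = E₃ := by
    ext i j
    fin_cases i <;> fin_cases j <;> simp [mul_apply, E₃, mul_comm (conj D), hDD]
  refine ⟨⟨!![a, c / D; b, d / D], ?_⟩, ?_, ?_⟩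
  · rw [det_fin_two_of, ← mul_div_assoc, div_mul_eq_mul_div, ← sub_div, ← hD, div_self hD0]
  · change X = !![a, c / D; b, d / D] * !![a, c / D; b, d / D]ᴴ
    rw [hfac, conjTranspose_mul, Matrix.mul_assoc, ← Matrix.mul_assoc _ _ (!![a, c; b, d]ᴴ), hU,
      Matrix.one_mul, hXe]
  · change N = !![a, c / D; b, d / D] * E₃ * !![a, c / D; b, d / D]ᴴ
    rw [hfac, conjTranspose_mul]
    simp only [Matrix.mul_assoc] at hU' hNe ⊢
    rw [← Matrix.mul_assoc E₃, ← Matrix.mul_assoc _ (E₃ * _), hU', hNe]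

/-! ### Transitions along an edge -/

/-- The normal form of the transition between frames at the two ends of an edge. -/
structure IsTransition (X N X' N' : Herm2) (M : SpecialLinearGroup (Fin 2) ℂ) (ρ : ℝ) :
    Prop where
  ne_zero : ρ ≠ 0
  apply_one_one : M 1 1 = conj (M 0 0)
  apply_one_zero : M 1 0 = ρ * conj (M 0 1)
  apply_zero_zero_ne : M 0 0 ≠ 0
  apply_zero_one_ne : M 0 1 ≠ 0
  coefficient : X' + N' - (X + N) = ρ • (X' - N' - (X - N))

/-- If `M` preserves the Hermitian form `diag(d₁, d₂)`, it has the form of an element of `SU(2)`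
or `SU(1, 1)`. -/
theorem entries_of_preserves {M : SpecialLinearGroup (Fin 2) ℂ} {d₁ d₂ : ℝ}
    (h : (M : Matrix (Fin 2) (Fin 2) ℂ) * !![(d₁ : ℂ), 0; 0, (d₂ : ℂ)] *
      (M : Matrix (Fin 2) (Fin 2) ℂ)ᴴ = !![(d₁ : ℂ), 0; 0, (d₂ : ℂ)]) :
    d₁ * M 0 0 = d₁ * conj (M 1 1) ∧ d₂ * M 0 1 = -(d₁ * conj (M 1 0)) ∧
      d₁ * M 1 0 = -(d₂ * conj (M 0 1)) ∧ d₂ * M 1 1 = d₂ * conj (M 0 0) := by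
  have hdet : M 0 0 * M 1 1 - M 0 1 * M 1 0 = 1 := by
    rw [← det_fin_two]; exact M.det_coe
  have hdet' := congrArg conj hdet
  have h₀₀ := congrFun₂ h 0 0
  have h₀₁ := congrFun₂ h 0 1
  have h₁₀ := congrFun₂ h 1 0
  have h₁₁ := congrFun₂ h 1 1
  simp [mul_apply] at h₀₀ h₀₁ h₁₀ h₁₁ hdet'
  -- With `D = diag(d₁, d₂)`, these are the entries of `M D = D (M*)⁻¹`, the inverse being the
  -- adjugate.
  refine ⟨?_, ?_, ?_, ?_⟩
  · linear_combination conj (M 1 1) * h₀₀ - conj (M 0 1) * h₀₁ - d₁ * M 0 0 * hdet'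
  · linear_combination -conj (M 1 0) * h₀₀ + conj (M 0 0) * h₀₁ - d₂ * M 0 1 * hdet'
  · linear_combination -conj (M 0 1) * h₁₁ + conj (M 1 1) * h₁₀ - d₁ * M 1 0 * hdet'
  · linear_combination conj (M 0 0) * h₁₁ - conj (M 1 0) * h₁₀ - d₂ * M 1 1 * hdet'

theorem IsFrame.combination {X N : Herm2} {F : SpecialLinearGroup (Fin 2) ℂ} (h : IsFrame X N F)
    (c d : ℝ) : ((c • X + d • N : Herm2) : Matrix (Fin 2) (Fin 2) ℂ) =
      F * !![((c + d : ℝ) : ℂ), 0; 0, ((c - d : ℝ) : ℂ)] * (F : Matrix (Fin 2) (Fin 2) ℂ)ᴴ := by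
  have : !![((c + d : ℝ) : ℂ), 0; 0, ((c - d : ℝ) : ℂ)] = c • 1 + d • E₃ := by
    ext i j
    fin_cases i <;> fin_cases j <;> simp [E₃, sub_eq_add_neg]
  rw [this]
  simp [h.point, h.normal, Matrix.mul_add, Matrix.add_mul]

/-- A common curvature sphere has equal `Herm2` parts `c X + d N = c X' + d N'`; conjugating back by
`F` shows that `M` preserves `diag(c + d, c - d)`. A zero entry of `M` would make a column of `F'`
proportional to one of `F`, so that two Gauss map values would coincide. -/
theorem isTransition_of_isFrame {X N X' N' : Herm2} {F F' : SpecialLinearGroup (Fin 2) ℂ}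
    (hF : IsFrame X N F) (hF' : IsFrame X' N' F')
    (hκ : contactElement X N ⊓ contactElement X' N' ≠ ⊥)
    (hP : Submodule.span ℝ {X + N} ≠ Submodule.span ℝ {X' + N'})
    (hQ : Submodule.span ℝ {X - N} ≠ Submodule.span ℝ {X' - N'})
    (hPQ : Submodule.span ℝ {X + N} ≠ Submodule.span ℝ {X' - N'}) :
    ∃ ρ, IsTransition X N X' N' (F⁻¹ * F') ρ := by
  obtain ⟨M, hM⟩ : ∃ M, M = F⁻¹ * F' := ⟨_, rfl⟩
  rw [← hM]
  have hFM : F' = F * M := by rw [hM, mul_inv_cancel_left]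
  have hFM' : (F' : Matrix (Fin 2) (Fin 2) ℂ) = F * M := by rw [hFM]; rfl
  have hdet : M 0 0 * M 1 1 - M 0 1 * M 1 0 = 1 := by
    rw [← det_fin_two]; exact M.det_coe
  have hspan {x y : Herm2} {c : ℂ} (hc : c ≠ 0) (h : (y : Matrix (Fin 2) (Fin 2) ℂ) =
      (c * conj c) • (x : Matrix (Fin 2) (Fin 2) ℂ)) :
      Submodule.span ℝ {x} = Submodule.span ℝ {y} := by
    have hn : Complex.normSq c ≠ 0 := by simpa using hc
    have : y = Complex.normSq c • x := by
      apply Subtype.ext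
      rw [h, Complex.mul_conj]
      ext i j
      simp
    rw [this, Submodule.span_singleton_smul_eq hn.isUnit]
  have hcomb' (c d : ℝ) : ((c • X' + d • N' : Herm2) : Matrix (Fin 2) (Fin 2) ℂ) =
      F * (M * !![((c + d : ℝ) : ℂ), 0; 0, ((c - d : ℝ) : ℂ)] *
        (M : Matrix (Fin 2) (Fin 2) ℂ)ᴴ) * (F : Matrix (Fin 2) (Fin 2) ℂ)ᴴ := by
    rw [hF'.combination, hFM', conjTranspose_mul]
    simp only [Matrix.mul_assoc]
  have h10 : M 1 0 ≠ 0 := by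
    intro h0
    rw [h0, mul_zero, sub_zero] at hdet
    refine hP (hspan (c := M 0 0) (left_ne_zero_of_mul_eq_one hdet) ?_)
    have e := hcomb' 1 1
    have e' := hF.combination 1 1
    simp only [one_smul] at e e'
    rw [e, e', ← Matrix.smul_mul, ← Matrix.mul_smul]
    congr 2
    ext i j
    fin_cases i <;> fin_cases j <;> simp [mul_apply, h0]
    ring
  have h01 : M 0 1 ≠ 0 := by
    intro h0
    rw [h0, zero_mul, sub_zero] at hdet
    refine hQ (hspan (c := M 1 1) (right_ne_zero_of_mul_eq_one hdet) ?_)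
    have e := hcomb' 1 (-1)
    have e' := hF.combination 1 (-1)
    simp only [one_smul, neg_smul, ← sub_eq_add_neg] at e e'
    rw [e, e', ← Matrix.smul_mul, ← Matrix.mul_smul]
    congr 2
    ext i j
    fin_cases i <;> fin_cases j <;> simp [mul_apply, h0]
    ring
  have h11 : M 1 1 ≠ 0 := by
    intro h0
    refine hPQ (hspan (c := M 0 1) h01 ?_)
    have e := hcomb' 1 (-1)
    have e' := hF.combination 1 1
    simp only [one_smul, neg_smul, ← sub_eq_add_neg] at e e'
    rw [e, e', ← Matrix.smul_mul, ← Matrix.mul_smul]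
    congr 2
    ext i j
    fin_cases i <;> fin_cases j <;> simp [mul_apply, h0]
    ring
  obtain ⟨v, hv, hv0⟩ := (Submodule.ne_bot_iff _).mp hκ
  obtain ⟨hv₁, hv₂⟩ := hv
  obtain ⟨c, d, h₁⟩ := Submodule.mem_span_pair.mp hv₁
  obtain ⟨c', d', h₂⟩ := Submodule.mem_span_pair.mp hv₂
  rw [← h₁] at h₂ hv0
  simp only [Prod.smul_mk, Prod.mk_add_mk, smul_eq_mul, mul_zero, mul_one, mul_neg, zero_add,
    add_zero, Prod.mk.injEq, neg_inj] at h₂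
  obtain ⟨h₃, rfl, rfl⟩ := h₂
  have hpres : (M : Matrix (Fin 2) (Fin 2) ℂ) * !![((c' + d' : ℝ) : ℂ), 0; 0, ((c' - d' : ℝ) : ℂ)] *
      (M : Matrix (Fin 2) (Fin 2) ℂ)ᴴ = !![((c' + d' : ℝ) : ℂ), 0; 0, ((c' - d' : ℝ) : ℂ)] := by
    have e := congrArg (Subtype.val) h₃
    rw [hcomb', hF.combination] at e
    have u : IsUnit (F : Matrix (Fin 2) (Fin 2) ℂ) := by
      rw [isUnit_iff_isUnit_det, F.det_coe]; exact isUnit_one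
    exact u.mul_left_cancel (((isUnit_conjTranspose _).mpr u).mul_right_cancel e)
  obtain ⟨m₁, m₂, m₃, m₄⟩ := entries_of_preserves hpres
  have hd₁ : c' + d' ≠ 0 := by
    intro h0
    have h1 : c' - d' = 0 := by
      rw [h0, Complex.ofReal_zero, zero_mul, neg_zero] at m₂
      exact_mod_cast (mul_eq_zero.mp m₂).resolve_right h01
    obtain rfl : c' = 0 := by linarith
    obtain rfl : d' = 0 := by linarith
    simp at hv0
  have hd₁' : ((c' + d' : ℝ) : ℂ) ≠ 0 := by exact_mod_cast hd₁
  have hd₂ : c' - d' ≠ 0 := by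
    intro h0
    have h1 : c' + d' = 0 := by
      rw [h0, Complex.ofReal_zero, zero_mul, neg_zero] at m₃
      exact_mod_cast (mul_eq_zero.mp m₃).resolve_right h10
    exact hd₁ h1
  have e11 : M 1 1 = conj (M 0 0) := mul_left_cancel₀ (by exact_mod_cast hd₂) m₄
  -- In terms of `X ± N`, equality of the curvature spheres reads `(c' + d') d(X + N) + (c' - d')
  -- d(X - N) = 0`.
  refine ⟨-(c' - d') / (c' + d'), ⟨div_ne_zero (neg_ne_zero.mpr hd₂) hd₁, e11, ?_, ?_, h01, ?_⟩⟩
  · rw [Complex.ofReal_div, div_mul_eq_mul_div, eq_div_iff hd₁', mul_comm, m₃]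
    push_cast; ring
  · intro h0
    exact h11 (by rw [e11, h0, map_zero])
  · refine smul_right_injective _ hd₁ ?_
    simp only [smul_smul, mul_div_cancel₀ _ hd₁]
    linear_combination (norm := module) (2 : ℝ) • h₃

theorem IsTransition.det_eq {X N X' N' : Herm2} {M : SpecialLinearGroup (Fin 2) ℂ} {ρ : ℝ}
    (h : IsTransition X N X' N' M ρ) :
    M 0 0 * conj (M 0 0) - ρ * (M 0 1 * conj (M 0 1)) = 1 := by
  have : M 0 0 * M 1 1 - M 0 1 * M 1 0 = 1 := by
    rw [← det_fin_two]; exact M.det_coe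
  rw [h.apply_one_one, h.apply_one_zero] at this
  linear_combination this

/-! ### Closing conditions on a face -/

/-- The consequences of the closing condition `M₁ M₂ = M₄ M₃` on a face of Gauss curvature `1`. -/
structure IsClosedFace (M₁ M₂ M₃ M₄ : SpecialLinearGroup (Fin 2) ℂ) (ρ₁ ρ₂ ρ₃ ρ₄ : ℝ) : Prop where
  ne₁₂ : ρ₁ ≠ ρ₂
  ne₁₄ : ρ₁ ≠ ρ₄
  diag : M₁ 0 0 * M₂ 0 0 = M₄ 0 0 * M₃ 0 0
  offDiag : ρ₁ * (M₁ 0 1 * conj (M₂ 0 1)) = ρ₄ * (M₄ 0 1 * conj (M₃ 0 1))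
  offDiag' : ρ₂ * (M₁ 0 1 * conj (M₂ 0 1)) = ρ₃ * (M₄ 0 1 * conj (M₃ 0 1))
  sum : M₁ 0 0 * M₂ 0 1 + M₁ 0 1 * conj (M₂ 0 0) = M₄ 0 0 * M₃ 0 1 + M₄ 0 1 * conj (M₃ 0 0)
  sum' : ρ₂ * (M₁ 0 0 * M₂ 0 1) + ρ₁ * (M₁ 0 1 * conj (M₂ 0 0)) =
    ρ₃ * (M₄ 0 0 * M₃ 0 1) + ρ₄ * (M₄ 0 1 * conj (M₃ 0 0))

/-- The diagonal entries of `M₁ M₂ = M₄ M₃`, one of them conjugated, differ only in the weights `ρ`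
of the off-diagonal products. Subtracting them and using `ρ₁ ρ₃ = ρ₂ ρ₄` with `ρ₁ ≠ ρ₂` separates
diagonal from off-diagonal products. -/
theorem IsGaussCurvature.isClosedFace {V : Type*} {X N : V → Herm2} {i j k l : V}
    (h : IsGaussCurvature X N i j k l 1) {M₁ M₂ M₃ M₄ : SpecialLinearGroup (Fin 2) ℂ}
    {ρ₁ ρ₂ ρ₃ ρ₄ : ℝ} (h₁ : IsTransition (X i) (N i) (X j) (N j) M₁ ρ₁)
    (h₂ : IsTransition (X j) (N j) (X k) (N k) M₂ ρ₂)
    (h₃ : IsTransition (X l) (N l) (X k) (N k) M₃ ρ₃)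
    (h₄ : IsTransition (X i) (N i) (X l) (N l) M₄ ρ₄) (hM : M₁ * M₂ = M₄ * M₃) :
    IsClosedFace M₁ M₂ M₃ M₄ ρ₁ ρ₂ ρ₃ ρ₄ := by
  obtain ⟨hπ, h12, h14⟩ := h.edge_coefficients h₁.ne_zero h₁.coefficient h₂.coefficient
    h₃.coefficient h₄.coefficient
  have hM (i j : Fin 2) : M₁ i 0 * M₂ 0 j + M₁ i 1 * M₂ 1 j = M₄ i 0 * M₃ 0 j + M₄ i 1 * M₃ 1 j := by
    have := congrArg (fun M : SpecialLinearGroup (Fin 2) ℂ ↦ M i j) hM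
    simpa [mul_apply] using this
  have a := hM 0 0
  have b := hM 0 1
  have c := congrArg conj (hM 1 0)
  have d := congrArg conj (hM 1 1)
  simp only [h₁.apply_one_one, h₂.apply_one_one, h₃.apply_one_one, h₄.apply_one_one,
    h₁.apply_one_zero, h₂.apply_one_zero, h₃.apply_one_zero, h₄.apply_one_zero, map_add, map_mul,
    Complex.conj_conj, Complex.conj_ofReal] at a b c d
  have hne : (ρ₂ - ρ₁ : ℂ) ≠ 0 := by exact_mod_cast sub_ne_zero.mpr h12.symm
  have hπ' : (ρ₁ * ρ₃ : ℂ) = ρ₂ * ρ₄ := by exact_mod_cast hπ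
  have o : ρ₁ * (M₁ 0 1 * conj (M₂ 0 1)) = ρ₄ * (M₄ 0 1 * conj (M₃ 0 1)) := by
    refine mul_left_cancel₀ hne ?_
    linear_combination ρ₁ * (a - d) + (M₄ 0 1 * conj (M₃ 0 1)) * hπ'
  have o' : ρ₂ * (M₁ 0 1 * conj (M₂ 0 1)) = ρ₃ * (M₄ 0 1 * conj (M₃ 0 1)) := by
    refine mul_left_cancel₀ hne ?_
    linear_combination ρ₂ * (a - d) + (M₄ 0 1 * conj (M₃ 0 1)) * hπ'
  exact ⟨h12, h14, by linear_combination a - o', o, o', b, by linear_combination c⟩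

/-! ### Rotations of the frame about the normal -/

/-- The diagonal matrix with entries `z⁻¹`, `z`. -/
noncomputable def circleRotation (z : Circle) : SpecialLinearGroup (Fin 2) ℂ :=
  ⟨!![((z⁻¹ : Circle) : ℂ), 0; 0, z], by simp⟩

/-- The frame obtained from `F` by a rotation about the normal. -/
noncomputable def rotateFrame (F : SpecialLinearGroup (Fin 2) ℂ) (z : Circle) :
    SpecialLinearGroup (Fin 2) ℂ :=
  F * circleRotation z

theorem IsFrame.rotate {X N : Herm2} {F : SpecialLinearGroup (Fin 2) ℂ} (h : IsFrame X N F)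
    (z : Circle) : IsFrame X N (rotateFrame F z) := by
  have e : (rotateFrame F z : Matrix (Fin 2) (Fin 2) ℂ) = F * !![((z⁻¹ : Circle) : ℂ), 0; 0, z] :=
    rfl
  have hz : (z : ℂ) * conj (z : ℂ) = 1 := by simp [Complex.mul_conj]
  have hU : !![((z⁻¹ : Circle) : ℂ), 0; 0, z] * !![((z⁻¹ : Circle) : ℂ), 0; 0, z]ᴴ = 1 := by
    rw [Circle.coe_inv_eq_conj]
    ext i j
    fin_cases i <;> fin_cases j <;> simp [mul_apply, hz, mul_comm (conj (z : ℂ))]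
  have hU' : !![((z⁻¹ : Circle) : ℂ), 0; 0, z] * E₃ * !![((z⁻¹ : Circle) : ℂ), 0; 0, z]ᴴ = E₃ := by
    rw [Circle.coe_inv_eq_conj]
    ext i j
    fin_cases i <;> fin_cases j <;> simp [mul_apply, E₃, hz, mul_comm (conj (z : ℂ))]
  constructor
  · rw [e, conjTranspose_mul, Matrix.mul_assoc,
      ← Matrix.mul_assoc _ _ (F : Matrix (Fin 2) (Fin 2) ℂ)ᴴ, hU, Matrix.one_mul, h.point]
  · rw [e, conjTranspose_mul]
    simp only [Matrix.mul_assoc] at hU' ⊢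
    rw [← Matrix.mul_assoc E₃, ← Matrix.mul_assoc _ (E₃ * _), hU', h.normal, Matrix.mul_assoc]

/-- Rotating the frames changes the phase of the diagonal entry by a coboundary, so an exact phase
can be removed. -/
theorem rotateFrame_inv_mul (F F' : SpecialLinearGroup (Fin 2) ℂ) (z z' : Circle) :
    ((rotateFrame F z)⁻¹ * rotateFrame F' z') 0 0 =
      ((z * z'⁻¹ : Circle) : ℂ) * (F⁻¹ * F') 0 0 := by
  have : (rotateFrame F z)⁻¹ * rotateFrame F' z' =
      (circleRotation z)⁻¹ * ((F⁻¹ * F') * circleRotation z') := by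
    rw [rotateFrame, rotateFrame]
    group
  rw [this]
  generalize F⁻¹ * F' = M
  change ((circleRotation z : Matrix (Fin 2) (Fin 2) ℂ).adjugate *
    ((M : Matrix (Fin 2) (Fin 2) ℂ) * (circleRotation z' : Matrix (Fin 2) (Fin 2) ℂ))) 0 0 = _
  simp [mul_apply, adjugate_fin_two, circleRotation, mul_assoc, mul_comm (M 0 0)]

theorem inv_mul_apply_zero_zero (F F' : SpecialLinearGroup (Fin 2) ℂ) :
    (F'⁻¹ * F) 0 0 = (F⁻¹ * F') 1 1 := by
  rw [show F'⁻¹ * F = (F⁻¹ * F')⁻¹ by group]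
  exact congrFun₂ (adjugate_fin_two _) 0 0

theorem inv_mul_apply_zero_one (F F' : SpecialLinearGroup (Fin 2) ℂ) :
    (F'⁻¹ * F) 0 1 = -(F⁻¹ * F') 0 1 := by
  rw [show F'⁻¹ * F = (F⁻¹ * F')⁻¹ by group]
  exact congrFun₂ (adjugate_fin_two _) 0 1

/-! ### Adapted frame and Weierstrass data -/

section Global

variable {V : Type*} {S : QuadComplex V} {X N : V → Herm2}

theorem exists_isTransition (hflat : IsFlatFront S X N) (hreg : RegularGaussMaps S X N)
    {F : V → SpecialLinearGroup (Fin 2) ℂ} (hF : ∀ i, IsFrame (X i) (N i) (F i)) (i j : V)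
    (h : S.graph.Adj i j) : ∃ ρ, IsTransition (X i) (N i) (X j) (N j) ((F i)⁻¹ * F j) ρ :=
  isTransition_of_isFrame (hF i) (hF j) (hflat.curvatureSphere i j h) (hreg i j h).1
    (hreg i j h).2.1 (hreg i j h).2.2

/-- A flat front on a simply connected complex has a frame such that the diagonals of all its
transition matrices are positive. -/
theorem exists_adapted_frame (hS : S.SimplyConnected) (hflat : IsFlatFront S X N)
    (hreg : RegularGaussMaps S X N) : ∃ F : V → SpecialLinearGroup (Fin 2) ℂ,
      (∀ i, IsFrame (X i) (N i) (F i)) ∧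
      ∀ i j, S.graph.Adj i j → ((F i)⁻¹ * F j) 0 0 = ‖((F i)⁻¹ * F j) 0 0‖ := by
  choose F hF using fun i ↦ exists_isFrame (hflat.mem_hyperbolicSpace i)
    (hflat.mem_deSitterSpace i) (hflat.orthogonal i)
  have htr := exists_isTransition hflat hreg hF
  have hpolar (z : ℂ) : ∃ w : Circle, z = ‖z‖ * w :=
    ⟨Circle.exp z.arg, by simp⟩
  choose ζ hζ using fun i j ↦ hpolar (((F i)⁻¹ * F j) 0 0)
  have hinv (i j : V) (h : S.graph.Adj i j) : ζ j i = (ζ i j)⁻¹ := by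
    obtain ⟨ρ, ht⟩ := htr i j h
    have e : ((F j)⁻¹ * F i) 0 0 = conj (((F i)⁻¹ * F j) 0 0) := by
      rw [inv_mul_apply_zero_zero, ht.apply_one_one]
    have hn : (‖((F i)⁻¹ * F j) 0 0‖ : ℂ) ≠ 0 := by
      exact_mod_cast norm_ne_zero_iff.mpr ht.apply_zero_zero_ne
    have e₁ := congrArg conj (hζ i j)
    have e₂ := hζ j i
    rw [map_mul, Complex.conj_ofReal] at e₁
    rw [e, Complex.norm_conj] at e₂
    apply Circle.ext
    refine mul_left_cancel₀ hn ?_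
    rw [Circle.coe_inv_eq_conj]
    exact e₂.symm.trans e₁
  -- The phases inherit multiplicativity from the diagonal entries once the equal moduli are
  -- cancelled.
  have hface (i j k l : V) (h : S.IsFace i j k l) : ζ i j * ζ j k = ζ i l * ζ l k := by
    obtain ⟨ρ₁, h₁⟩ := htr i j (S.adj₁ h)
    obtain ⟨ρ₂, h₂⟩ := htr j k (S.adj₂ h)
    obtain ⟨ρ₃, h₃⟩ := htr l k (S.adj₃ h).symm
    obtain ⟨ρ₄, h₄⟩ := htr i l (S.adj₄ h).symm
    have hd := ((hflat.gaussCurvature i j k l h).isClosedFace h₁ h₂ h₃ h₄ (by group)).diag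
    have hn := congrArg norm hd
    rw [norm_mul, norm_mul] at hn
    have hn' : (‖((F i)⁻¹ * F j) 0 0‖ : ℂ) * ‖((F j)⁻¹ * F k) 0 0‖ =
        ‖((F i)⁻¹ * F l) 0 0‖ * ‖((F l)⁻¹ * F k) 0 0‖ := by exact_mod_cast hn
    have hne : (‖((F i)⁻¹ * F j) 0 0‖ : ℂ) * ‖((F j)⁻¹ * F k) 0 0‖ ≠ 0 := by
      exact_mod_cast mul_ne_zero (norm_ne_zero_iff.mpr h₁.apply_zero_zero_ne)
        (norm_ne_zero_iff.mpr h₂.apply_zero_zero_ne)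
    rw [hζ i j, hζ j k, hζ i l, hζ l k] at hd
    apply Circle.ext
    refine mul_left_cancel₀ hne ?_
    rw [Circle.coe_mul, Circle.coe_mul]
    linear_combination hd - (ζ i l * ζ l k : ℂ) * hn'
  obtain ⟨φ, hφ⟩ := hS.exists_potential hinv hface
  refine ⟨fun i ↦ rotateFrame (F i) (φ i), fun i ↦ (hF i).rotate _, fun i j h ↦ ?_⟩
  have e : ((φ i * (φ j)⁻¹ : Circle) : ℂ) * ζ i j = 1 := by
    rw [← Circle.coe_mul, hφ i j h, mul_inv, mul_inv_cancel_left, inv_mul_cancel, Circle.coe_one]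
  have e' : (((rotateFrame (F i) (φ i))⁻¹ * rotateFrame (F j) (φ j)) 0 0 : ℂ) =
      ‖((F i)⁻¹ * F j) 0 0‖ := by
    rw [rotateFrame_inv_mul]
    linear_combination ((φ i * (φ j)⁻¹ : Circle) : ℂ) * hζ i j + ‖((F i)⁻¹ * F j) 0 0‖ * e
  rw [e', Complex.norm_real, norm_norm]

/-- The Weierstrass-type representation of flat fronts with regular hyperbolic Gauss maps. -/
theorem IsFlatFront.exists_isWeierstrassRepresentation (hS : S.SimplyConnected)
    (hflat : IsFlatFront S X N) (hreg : RegularGaussMaps S X N) :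
    ∃ (g : V → ℂ) (a : V → V → ℝ) (t : ℝ) (F : V → Matrix.SpecialLinearGroup (Fin 2) ℂ) (s : ℝ),
      IsWeierstrassRepresentation S X N g a t F s := by
  obtain ⟨F, hF, hpos⟩ := exists_adapted_frame hS hflat hreg
  have htr := exists_isTransition hflat hreg hF
  obtain ⟨r, hr⟩ : ∃ r : V → V → ℝ, ∀ i j, r i j = ‖((F i)⁻¹ * F j) 0 0‖ := ⟨_, fun _ _ ↦ rfl⟩
  obtain ⟨b, hb⟩ : ∃ b : V → V → ℂ, ∀ i j, b i j = ((F i)⁻¹ * F j) 0 1 / r i j :=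
    ⟨_, fun _ _ ↦ rfl⟩
  have hrpos (i j : V) (h : S.graph.Adj i j) : 0 < r i j := by
    obtain ⟨ρ, ht⟩ := htr i j h
    rw [hr]
    exact norm_pos_iff.mpr ht.apply_zero_zero_ne
  have hrne (i j : V) (h : S.graph.Adj i j) : (r i j : ℂ) ≠ 0 := by
    exact_mod_cast (hrpos i j h).ne'
  have hα (i j : V) (h : S.graph.Adj i j) : ((F i)⁻¹ * F j) 0 0 = r i j := by
    rw [hr]; exact hpos i j h
  have hβ (i j : V) (h : S.graph.Adj i j) : ((F i)⁻¹ * F j) 0 1 = r i j * b i j := by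
    rw [hb, mul_div_cancel₀ _ (hrne i j h)]
  have hrsymm (i j : V) (h : S.graph.Adj i j) : r j i = r i j := by
    obtain ⟨ρ, ht⟩ := htr i j h
    rw [hr, hr, inv_mul_apply_zero_zero, ht.apply_one_one, Complex.norm_conj]
  have hbne (i j : V) (h : S.graph.Adj i j) : b i j ≠ 0 := by
    obtain ⟨ρ, ht⟩ := htr i j h
    rw [hb]
    exact div_ne_zero ht.apply_zero_one_ne (hrne i j h)
  -- Chosen so that `1 / √(1 - a) = r`; the determinant condition then reads `ρ |b|² = a`.
  obtain ⟨a, ha⟩ : ∃ a : V → V → ℝ, ∀ i j, a i j = 1 - ((r i j) ^ 2)⁻¹ := ⟨_, fun _ _ ↦ rfl⟩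
  have hab (i j : V) (h : S.graph.Adj i j) {ρ : ℝ}
      (ht : IsTransition (X i) (N i) (X j) (N j) ((F i)⁻¹ * F j) ρ) :
      ρ * (b i j * conj (b i j)) = a i j := by
    have := ht.det_eq
    rw [hα i j h, hβ i j h, map_mul, Complex.conj_ofReal] at this
    have h0 := hrne i j h
    rw [ha]
    push_cast
    field_simp
    linear_combination -this
  have hface (i j k l : V) (h : S.IsFace i j k l) : b i j + b j k = b i l + b l k ∧
      a i j ≠ a i l ∧ a i j = a l k ∧ a j k = a i l ∧
      (b i j / b j k) * (b l k / b i l) = (a i j / a j k : ℝ) := by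
    have a₁ := S.adj₁ h
    have a₂ := S.adj₂ h
    have a₃ := (S.adj₃ h).symm
    have a₄ := (S.adj₄ h).symm
    obtain ⟨ρ₁, h₁⟩ := htr i j a₁
    obtain ⟨ρ₂, h₂⟩ := htr j k a₂
    obtain ⟨ρ₃, h₃⟩ := htr l k a₃
    obtain ⟨ρ₄, h₄⟩ := htr i l a₄
    obtain ⟨n₁₂, n₁₄, hd, o, o', s, s'⟩ :=
      (hflat.gaussCurvature i j k l h).isClosedFace h₁ h₂ h₃ h₄ (by group)
    simp only [hα _ _ a₁, hα _ _ a₂, hα _ _ a₃, hα _ _ a₄, hβ _ _ a₁, hβ _ _ a₂, hβ _ _ a₃,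
      hβ _ _ a₄, map_mul, Complex.conj_ofReal] at hd o o' s s'
    have hne : (r i j * r j k : ℂ) ≠ 0 := mul_ne_zero (hrne _ _ a₁) (hrne _ _ a₂)
    have hs : b i j + b j k = b i l + b l k := by
      refine mul_left_cancel₀ hne ?_
      linear_combination s - (b i l + b l k) * hd
    have hd' : r i j * r j k = r i l * r l k := by exact_mod_cast hd
    refine ⟨hs, labels_of_closed (hbne _ _ a₁) (hbne _ _ a₂) (hbne _ _ a₃) (hbne _ _ a₄) n₁₂ n₁₄
      h₁.ne_zero (hab _ _ a₁ h₁) (hab _ _ a₂ h₂) (hab _ _ a₃ h₃) (hab _ _ a₄ h₄) ?_ ?_ hs ?_ ?_⟩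
    · refine mul_left_cancel₀ hne ?_
      linear_combination o - ρ₄ * (b i l * conj (b l k)) * hd
    · refine mul_left_cancel₀ hne ?_
      linear_combination o' - ρ₃ * (b i l * conj (b l k)) * hd
    · refine mul_left_cancel₀ hne ?_
      linear_combination s' - (ρ₄ * b i l + ρ₃ * b l k) * hd
    · simp only [ha, sub_sub_cancel]
      rw [← mul_inv, ← mul_inv, ← mul_pow, ← mul_pow, hd']
  -- The additive function `b` is integrated as a multiplicative one.
  obtain ⟨g, hg⟩ := hS.exists_potential (f := fun i j ↦ Multiplicative.ofAdd (b i j))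
    (fun i j h ↦ by
      rw [← ofAdd_neg, hb, hb, hrsymm i j h, inv_mul_apply_zero_one, neg_div])
    (fun i j k l h ↦ by rw [← ofAdd_add, ← ofAdd_add, (hface i j k l h).1])
  have hg (i j : V) (h : S.graph.Adj i j) : (g j).toAdd - (g i).toAdd = b i j := by
    rw [hg i j h, toAdd_mul, toAdd_ofAdd, add_sub_cancel_left]
  have hane (i j : V) (h : S.graph.Adj i j) : a i j ≠ 0 := by
    obtain ⟨ρ, ht⟩ := htr i j h
    have h0 : (a i j : ℂ) ≠ 0 := by
      rw [← hab i j h ht]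
      have := hbne i j h
      exact mul_ne_zero (by exact_mod_cast ht.ne_zero) (mul_ne_zero this (by simpa))
    exact_mod_cast h0
  have hasymm (i j : V) (h : S.graph.Adj i j) : a i j = a j i := by
    rw [ha, ha, hrsymm i j h]
  have hcr (i j k l : V) (h : S.IsFace i j k l) :
      crossRatio (g i).toAdd (g j).toAdd (g k).toAdd (g l).toAdd = (a i j / a j k : ℝ) := by
    rw [← (hface i j k l h).2.2.2.2, crossRatio, hg i j (S.adj₁ h), hg j k (S.adj₂ h),
      ← neg_sub (g k).toAdd (g l).toAdd, ← neg_sub (g l).toAdd (g i).toAdd,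
      hg i l (S.adj₄ h).symm, hg l k (S.adj₃ h).symm, neg_div_neg_eq]
  -- The scale of the labels is free, so `t = 1` can be taken; `s = 0` because the frames give `X =
  -- F F*` directly.
  refine ⟨fun i ↦ (g i).toAdd, a, 1, F, 0, ⟨⟨hasymm, fun i j k l h ↦ ?_⟩, fun i j h h0 ↦ ?_, hane,
    hcr, fun i j k l h ↦ ?_, fun i j k l h ↦ ?_⟩, one_ne_zero, fun i j h ↦ ?_, fun i j h ↦ ?_,
    fun i ↦ ?_, fun i ↦ ?_⟩
  · rw [(hface i j k l h).2.2.1, hasymm k l (S.adj₃ h)]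
  · exact hbne i j h (by rw [← hg i j h, h0, sub_self])
  · rw [hcr i j k l h]
    exact_mod_cast div_ne_zero (hane _ _ (S.adj₁ h)) (hane _ _ (S.adj₂ h))
  · rw [hcr i j k l h]
    have h' := hface i j k l h
    rw [h'.2.2.2.1]
    intro h1
    have h1 : a i j / a i l = 1 := by exact_mod_cast h1
    exact h'.2.1 ((div_eq_one_iff_eq (hane _ _ (S.adj₄ h).symm)).mp h1)
  · rw [one_mul, ha, sub_sub_cancel]
    have := hrpos i j h
    positivity
  · obtain ⟨ρ, ht⟩ := htr i j h
    have e : (F j : Matrix (Fin 2) (Fin 2) ℂ) = F i * ((F i)⁻¹ * F j : Matrix.SpecialLinearGroup _ ℂ) := by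
      exact congrArg Subtype.val (mul_inv_cancel_left (F i) (F j)).symm
    have hsq : (1 / (√(1 - 1 * a i j) : ℂ)) = r i j := by
      rw [one_mul, ha, sub_sub_cancel, Real.sqrt_inv, Real.sqrt_sq (hrpos i j h).le]
      simp
    have h11 : ((F i)⁻¹ * F j) 1 1 = r i j := by
      rw [ht.apply_one_one, hα i j h, Complex.conj_ofReal]
    have h10 : ((F i)⁻¹ * F j) 1 0 = r i j * (a i j / b i j) := by
      rw [ht.apply_one_zero, hβ i j h, ← hab i j h ht, map_mul, Complex.conj_ofReal]
      have := hbne i j h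
      field_simp
    rw [e]
    congr 1
    rw [transition, hsq, hg i j h]
    have h00 := hα i j h
    have h01 := hβ i j h
    generalize (F i)⁻¹ * F j = M at h00 h01 h10 h11
    ext m n
    fin_cases m <;> fin_cases n <;> simp [h00, h01, h10, h11]
  · have : E₀ = 1 := by ext m n; fin_cases m <;> fin_cases n <;> rfl
    simp [this, (hF i).point]
  · simp [(hF i).normal]

end Global

end FlatFront

theorem mainTheorem2 {V : Type*} (S : FlatFront.QuadComplex V) (hS : S.SimplyConnected)
    (X N : V → FlatFront.Herm2) (hflat : FlatFront.IsFlatFront S X N)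
    (hreg : FlatFront.RegularGaussMaps S X N) :
    ∃ (g : V → ℂ) (a : V → V → ℝ) (t : ℝ) (F : V → Matrix.SpecialLinearGroup (Fin 2) ℂ) (s : ℝ),
      FlatFront.IsWeierstrassRepresentation S X N g a t F s :=
  hflat.exists_isWeierstrassRepresentation hS hreg
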